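/- Let $n\ge 2$, and let $\mathbb{R}^n$ carry its Euclidean norm $|\cdot|$. Let $K\subset\mathbb{R}^n$ be a compact set with at least two elements, and let $\partial K$ denote its topological boundary. Suppose that for all $x,y\in\partial K$ and every $\sigma\in\mathbb{R}^n$ with $|\sigma|=1$, at least one of the two points $$\frac{x+y}{2}+\frac{|x-y|}{2}\,\sigma,\qquad \frac{x+y}{2}-\frac{|x-y|}{2}\,\sigma$$ belongs to $K$. Then $K$ is an $n$-dimensional Euclidean ball: there are $c\in\mathbb{R}^n$ and $r>0$ such that $K=\{z\in\mathbb{R}^n : |z-c|\le r\}$. -/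

import Mathlib

/-!
The hypothesis says: if two opposite vertices of a (planar) rectangle lie on `∂K`, then at least one
of the other two vertices lies in `K`. It is used for three families of rectangles.

* Let `x` and `y` maximize and minimize `⟪·, u⟫` on `K`, where `‖u‖ = 1`. If `x - y` were not
  parallel to `u`, the rectangle with diagonal `xy` whose other diagonal is parallel to `u` would
  have its other vertices strictly outside the supporting slab of `K`, one on each side. Hence
  `x - y` is the width of `K` in direction `u` times `u` (`IsSupportPair.sub_eq_norm_smul`).
* Consequently the widths `d` satisfy `d u' ≥ d u * ⟪u, u'⟫`, so `d` varies by at most a multiple of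
  the square of the angle and is constant, equal to `2R` say (`exists_width`). In particular `K` has
  diameter `2R`.
* Fix a support pair `c ± R • a`. If another support pair has a midpoint `c + d` with `d ⊥ a`, then
  the rectangle with vertices `c + d ± R • a` shows that `K` contains two points at distance
  `√(‖d‖² + 4R²)`, so `d = 0` (`eq_of_inner_midpoint_eq_zero`). If `K` stuck out of the ball
  `B(c, R)` on the side of a unit vector `e ⊥ a`, such a pair with `d ≠ 0` would be found by moving
  the centre of the ball in direction `e` until its support function dominates that of `K` in all
  directions `e + s • a` of the plane of `a` and `e`: equality then holds at some `s` to first order,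
  which makes `d` orthogonal to `a` (`subset_closedBall`). Thus `K ⊆ B(c, R)`, and
  since `K` has width `2R` in all directions, it contains the sphere (`sphere_subset_of_width`).
* Finally, any point `z` of the open ball is a vertex of a rectangle whose two neighbouring vertices
  lie on the sphere. The fourth vertex then lies outside the ball, hence `z ∈ K`
  (`closedBall_subset`).
-/

section Rectangle

variable {V : Type*} [NormedAddCommGroup V] [InnerProductSpace ℝ V]

/-- Whenever two opposite vertices `x, y` of a rectangle lie on the boundary of `K`, one of the other
two vertices `p, q` belongs to `K`. Rectangles are encoded by their diagonals having the same
midpoint and the same length. -/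
def RectangleProperty (K : Set V) : Prop :=
  ∀ x ∈ frontier K, ∀ y ∈ frontier K, ∀ p q : V, p + q = x + y → ‖p - q‖ = ‖x - y‖ →
    p ∈ K ∨ q ∈ K

/-- `x` and `y` are points of `K` on its supporting hyperplanes with outer normals `u` and `-u`. -/
structure IsSupportPair (K : Set V) (u x y : V) : Prop where
  left_mem : x ∈ K
  right_mem : y ∈ K
  le_left : ∀ z ∈ K, inner ℝ z u ≤ inner ℝ x u
  right_le : ∀ z ∈ K, inner ℝ y u ≤ inner ℝ z u

lemma IsSupportPair.neg {K : Set V} {u x y : V} (h : IsSupportPair K u x y) :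
    IsSupportPair K (-u) y x where
  left_mem := h.right_mem
  right_mem := h.left_mem
  le_left z hz := by simpa using h.right_le z hz
  right_le z hz := by simpa using h.le_left z hz

lemma exists_isSupportPair {K : Set V} (hK : IsCompact K) (hne : K.Nonempty) (u : V) :
    ∃ x y, IsSupportPair K u x y := by
  have hc : ContinuousOn (fun z : V => inner ℝ z u) K := by fun_prop
  obtain ⟨x, hx, hx'⟩ := hK.exists_isMaxOn hne hc
  obtain ⟨y, hy, hy'⟩ := hK.exists_isMinOn hne hc
  exact ⟨x, y, hx, hy, fun z hz => hx' hz, fun z hz => hy' hz⟩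

lemma mem_frontier_of_inner_le {K : Set V} {u x : V} (hu : ‖u‖ = 1) (hx : x ∈ K)
    (h : ∀ z ∈ K, inner ℝ z u ≤ inner ℝ x u) : x ∈ frontier K := by
  refine ⟨subset_closure hx, fun hint => ?_⟩
  obtain ⟨ε, hε, hball⟩ := Metric.mem_nhds_iff.1 (mem_interior_iff_mem_nhds.1 hint)
  have hmem : x + (ε / 2) • u ∈ K := hball (by
    simp [norm_smul, hu, abs_of_pos hε, hε])
  have := h _ hmem
  rw [inner_add_left, inner_smul_left, real_inner_self_eq_norm_sq, hu] at this
  simp at this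
  linarith

lemma IsSupportPair.left_mem_frontier {K : Set V} {u x y : V} (h : IsSupportPair K u x y)
    (hu : ‖u‖ = 1) : x ∈ frontier K :=
  mem_frontier_of_inner_le hu h.left_mem h.le_left

lemma IsSupportPair.right_mem_frontier {K : Set V} {u x y : V} (h : IsSupportPair K u x y)
    (hu : ‖u‖ = 1) : y ∈ frontier K :=
  h.neg.left_mem_frontier (by simpa using hu)

/-- The chord between opposite support points is normal to the supporting hyperplanes: otherwise the
rectangle having it as a diagonal and the other diagonal parallel to `u` violates the rectangle
property. -/
lemma IsSupportPair.sub_eq_norm_smul {K : Set V} (hR : RectangleProperty K) {u x y : V}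
    (hu : ‖u‖ = 1) (h : IsSupportPair K u x y) : x - y = ‖x - y‖ • u := by
  by_contra hne
  have hlt : inner ℝ (x - y) u < ‖x - y‖ * ‖u‖ := by
    rw [inner_lt_norm_mul_iff_real, hu, one_smul]
    exact hne
  have huu : inner ℝ u u = (1 : ℝ) := by rw [real_inner_self_eq_norm_sq, hu]; norm_num
  rw [hu, inner_sub_left] at hlt
  rcases hR x (h.left_mem_frontier hu) y (h.right_mem_frontier hu)
      ((1 / 2 : ℝ) • (x + y) + (‖x - y‖ / 2) • u) ((1 / 2 : ℝ) • (x + y) - (‖x - y‖ / 2) • u)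
      (by module) (by
        rw [show (1 / 2 : ℝ) • (x + y) + (‖x - y‖ / 2) • u
          - ((1 / 2 : ℝ) • (x + y) - (‖x - y‖ / 2) • u) = ‖x - y‖ • u by module, norm_smul, hu]
        simp) with hp | hq
  · have := h.le_left _ hp
    simp only [inner_add_left, real_inner_smul_left, huu] at this
    linarith
  · have := h.right_le _ hq
    simp only [inner_add_left, inner_sub_left, real_inner_smul_left, huu] at this
    linarith

/-! ### Orthonormal decompositions -/

lemma exists_unit_orthogonal (hV : 2 ≤ Module.finrank ℝ V) {a : V} (ha : ‖a‖ = 1) :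
    ∃ e : V, ‖e‖ = 1 ∧ inner ℝ a e = 0 := by
  have : FiniteDimensional ℝ V := Module.finite_of_finrank_pos (by omega)
  have h1 := (ℝ ∙ a).finrank_add_finrank_orthogonal
  rw [finrank_span_singleton (norm_ne_zero_iff.1 (by rw [ha]; norm_num))] at h1
  have : Nontrivial (ℝ ∙ a)ᗮ := Module.nontrivial_of_finrank_pos (R := ℝ) (by omega)
  obtain ⟨w, hw⟩ := exists_ne (0 : (ℝ ∙ a)ᗮ)
  have hw0 : (w : V) ≠ 0 := by simpa using hw
  refine ⟨‖(w : V)‖⁻¹ • (w : V), norm_smul_inv_norm hw0, ?_⟩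
  rw [inner_smul_right, Submodule.mem_orthogonal_singleton_iff_inner_right.1 w.2, mul_zero]

/-- Every vector lies in a half-plane spanned by a given unit vector `a` and some unit vector
orthogonal to it, even if it is parallel to `a`. -/
lemma exists_decomposition (hV : 2 ≤ Module.finrank ℝ V) {a : V} (ha : ‖a‖ = 1) (v : V) :
    ∃ e : V, ‖e‖ = 1 ∧ inner ℝ a e = 0 ∧ ∃ α β : ℝ, 0 ≤ β ∧ v = α • a + β • e := by
  have haa : inner ℝ a a = (1 : ℝ) := by rw [real_inner_self_eq_norm_sq, ha]; norm_num
  set w := v - (inner ℝ a v : ℝ) • a with hw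
  by_cases hw0 : w = 0
  · obtain ⟨e, he, hae⟩ := exists_unit_orthogonal hV ha
    exact ⟨e, he, hae, inner ℝ a v, 0, le_rfl, by rw [zero_smul, add_zero, ← sub_eq_zero, ← hw, hw0]⟩
  · refine ⟨‖w‖⁻¹ • w, norm_smul_inv_norm hw0, ?_, inner ℝ a v, ‖w‖, norm_nonneg _, ?_⟩
    · rw [inner_smul_right, hw, inner_sub_right, inner_smul_right, haa]
      ring
    · rw [smul_smul, mul_inv_cancel₀ (norm_ne_zero_iff.2 hw0), one_smul, hw]
      abel

lemma norm_sq_smul_add_smul {a e : V} (ha : ‖a‖ = 1) (he : ‖e‖ = 1) (hae : inner ℝ a e = (0 : ℝ))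
    (α β : ℝ) : ‖α • a + β • e‖ ^ 2 = α ^ 2 + β ^ 2 := by
  rw [norm_add_sq_real, norm_smul, norm_smul, real_inner_smul_left, real_inner_smul_right, hae, ha,
    he]
  simp

/-! ### Constant width -/

/-- A set with the rectangle property has constant width `2R`, and any two
opposite support points differ by `2R` times the normal direction. -/
lemma exists_width (hV : 2 ≤ Module.finrank ℝ V) {K : Set V} (hK : IsCompact K)
    (hK2 : K.Nontrivial) (hR : RectangleProperty K) :
    ∃ R : ℝ, 0 < R ∧ ∀ u x y : V, ‖u‖ = 1 → IsSupportPair K u x y → x - y = (2 * R) • u := by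
  choose X Y hXY using exists_isSupportPair hK hK2.nonempty
  set d : V → ℝ := fun u => ‖X u - Y u‖ with hd
  have hpair {u x y : V} (hu : ‖u‖ = 1) (h : IsSupportPair K u x y) : x - y = d u • u := by
    have h1 : inner ℝ (x - y) u = inner ℝ (X u - Y u) u := by
      have := h.le_left _ (hXY u).left_mem
      have := h.right_le _ (hXY u).right_mem
      have := (hXY u).le_left _ h.left_mem
      have := (hXY u).right_le _ h.right_mem
      rw [inner_sub_left, inner_sub_left]
      linarith
    have h2 := h.sub_eq_norm_smul hR hu
    have h3 := (hXY u).sub_eq_norm_smul hR hu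
    rw [h2, h3, real_inner_smul_left, real_inner_smul_left, real_inner_self_eq_norm_sq, hu] at h1
    rw [h2]
    simp only [hd]
    congr 1
    simpa using h1
  have hle {u' : V} (hu' : ‖u'‖ = 1) {x y : V} (hx : x ∈ K) (hy : y ∈ K) :
      inner ℝ (x - y) u' ≤ d u' := by
    have h1 := (hXY u').le_left _ hx
    have h2 := (hXY u').right_le _ hy
    have h3 : inner ℝ (X u' - Y u') u' = d u' := by
      rw [hpair hu' (hXY u'), real_inner_smul_left, real_inner_self_eq_norm_sq, hu']; ring
    rw [inner_sub_left] at h3 ⊢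
    linarith
  have hmul {u u' : V} (hu : ‖u‖ = 1) (hu' : ‖u'‖ = 1) : d u * inner ℝ u u' ≤ d u' := by
    have := hle hu' (hXY u).left_mem (hXY u).right_mem
    rwa [hpair hu (hXY u), real_inner_smul_left] at this
  have hdiam (u : V) : d u ≤ Metric.diam K := by
    simp only [hd, ← dist_eq_norm]
    exact Metric.dist_le_diam_of_mem hK.isBounded (hXY u).left_mem (hXY u).right_mem
  have hdiff {u u' : V} (hu : ‖u‖ = 1) (hu' : ‖u'‖ = 1) :
      |d u - d u'| ≤ Metric.diam K * (1 - inner ℝ u u') := by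
    have h1 := hmul hu hu'
    have h2 := hmul hu' hu
    rw [real_inner_comm] at h2
    have h3 : inner ℝ u u' ≤ (1 : ℝ) := by
      simpa [hu, hu'] using real_inner_le_norm u u'
    have h4 := mul_le_mul_of_nonneg_right (hdiam u) (sub_nonneg.2 h3)
    have h5 := mul_le_mul_of_nonneg_right (hdiam u') (sub_nonneg.2 h3)
    rw [abs_le]
    constructor <;> linarith
  -- Along a great circle the width has derivative zero.
  have hconst {u u' : V} (hu : ‖u‖ = 1) (hu' : ‖u'‖ = 1) : d u = d u' := by
    obtain ⟨e, he, hue, α, β, hβ, rfl⟩ := exists_decomposition hV hu u'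
    have hαβ : α ^ 2 + β ^ 2 = 1 := by
      rw [← norm_sq_smul_add_smul hu he hue, hu']; norm_num
    set c : ℝ → V := fun t => Real.cos t • u + Real.sin t • e with hc
    have hcn (t : ℝ) : ‖c t‖ = 1 := by
      rw [← sq_eq_sq₀ (norm_nonneg _) zero_le_one, norm_sq_smul_add_smul hu he hue]
      simp
    have hcc (s t : ℝ) : inner ℝ (c s) (c t) = Real.cos (s - t) := by
      simp only [hc, inner_add_left, inner_add_right, real_inner_smul_left, real_inner_smul_right,
        hue, real_inner_comm u e, real_inner_self_eq_norm_sq, hu, he, Real.cos_sub]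
      ring
    have hder (t : ℝ) : HasDerivAt (fun s => d (c s) - d (c t)) 0 t := by
      have hO : (fun s => d (c s) - d (c t)) =O[nhds t] fun s => ‖s - t‖ ^ 2 := by
        refine Asymptotics.IsBigO.of_bound (Metric.diam K / 2) (Filter.Eventually.of_forall fun s => ?_)
        have h1 := hdiff (hcn s) (hcn t)
        rw [hcc] at h1
        have h2 := Real.one_sub_sq_div_two_le_cos (x := s - t)
        have h3 : Metric.diam K * (1 - Real.cos (s - t)) ≤ Metric.diam K * ((s - t) ^ 2 / 2) :=
          mul_le_mul_of_nonneg_left (by linarith) Metric.diam_nonneg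
        simp only [Real.norm_eq_abs, sq_abs, abs_pow]
        linarith
      simpa using (hO.hasFDerivAt (𝕜 := ℝ) one_lt_two).hasDerivAt
    have hder' (t : ℝ) : HasDerivAt (fun s => d (c s)) 0 t := by
      simpa using (hder t).add_const (d (c t))
    have h0 := is_const_of_deriv_eq_zero (fun t => (hder' t).differentiableAt)
      (fun t => (hder' t).deriv) 0 (Real.arccos α)
    have hα1 : -1 ≤ α := by nlinarith
    have hα2 : α ≤ 1 := by nlinarith
    simpa [hc, Real.cos_arccos hα1 hα2, Real.sin_arccos,
      show 1 - α ^ 2 = β ^ 2 by linarith, Real.sqrt_sq hβ] using h0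
  obtain ⟨x, hx, y, hy, hxy⟩ := hK2
  have hxy' : x - y ≠ 0 := sub_ne_zero.2 hxy
  have hu0 : ‖‖x - y‖⁻¹ • (x - y)‖ = 1 := norm_smul_inv_norm hxy'
  refine ⟨d (‖x - y‖⁻¹ • (x - y)) / 2, ?_, fun u x' y' hu h => ?_⟩
  · have h1 := hle hu0 hx hy
    rw [real_inner_smul_right, real_inner_self_eq_norm_sq] at h1
    have := norm_pos_iff.2 hxy'
    have : 0 < ‖x - y‖⁻¹ * ‖x - y‖ ^ 2 := by positivity
    linarith
  · rw [hpair hu h, hconst hu hu0]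
    congr 1
    ring

lemma norm_sub_le_of_width {K : Set V} (hK : IsCompact K) {R : ℝ} (hR0 : 0 < R)
    (hw : ∀ u x y : V, ‖u‖ = 1 → IsSupportPair K u x y → x - y = (2 * R) • u)
    {x y : V} (hx : x ∈ K) (hy : y ∈ K) : ‖x - y‖ ≤ 2 * R := by
  by_cases hxy : x - y = 0
  · rw [hxy, norm_zero]; positivity
  have hu : ‖‖x - y‖⁻¹ • (x - y)‖ = 1 := norm_smul_inv_norm hxy
  set u := ‖x - y‖⁻¹ • (x - y) with hudef
  obtain ⟨x', y', h⟩ := exists_isSupportPair hK ⟨x, hx⟩ u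
  have h1 := h.le_left _ hx
  have h2 := h.right_le _ hy
  have h3 : inner ℝ (x' - y') u = 2 * R := by
    rw [hw u x' y' hu h, real_inner_smul_left, real_inner_self_eq_norm_sq, hu]; ring
  have h4 : inner ℝ (x - y) u = ‖x - y‖ := by
    have := norm_ne_zero_iff.2 hxy
    rw [hudef, real_inner_smul_right, real_inner_self_eq_norm_sq]
    field_simp
  rw [inner_sub_left] at h3 h4
  linarith

/-! ### The circumscribed ball -/

/-- Two support pairs have the same midpoint as soon as the difference of their midpoints is
orthogonal to one of the two directions. -/
lemma eq_of_inner_midpoint_eq_zero {K : Set V} (hR : RectangleProperty K) {R : ℝ} (hR0 : 0 < R)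
    (hdiam : ∀ x ∈ K, ∀ y ∈ K, ‖x - y‖ ≤ 2 * R) {a c u m : V} (ha : ‖a‖ = 1) (hu : ‖u‖ = 1)
    (hc₁ : c + R • a ∈ K) (hc₂ : c - R • a ∈ K) (hm : IsSupportPair K u (m + R • u) (m - R • u))
    (h0 : inner ℝ (m - c) a = 0) : m = c := by
  have key {w z : V} (hw : w ∈ K) (hz : z ∈ K)
      (h : ‖w - z‖ ^ 2 = ‖m - c‖ ^ 2 + (2 * R) ^ 2) : m = c := by
    have h1 := pow_le_pow_left₀ (norm_nonneg _) (hdiam w hw z hz) 2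
    rw [h] at h1
    have h2 : ‖m - c‖ ^ 2 = 0 := le_antisymm (by linarith) (sq_nonneg _)
    exact sub_eq_zero.1 (norm_eq_zero.1 (by simpa using h2))
  rcases hR _ (hm.left_mem_frontier hu) _ (hm.right_mem_frontier hu) (m + R • a) (m - R • a)
      (by abel) (by
        rw [show m + R • a - (m - R • a) = (2 * R) • a by module,
          show m + R • u - (m - R • u) = (2 * R) • u by module, norm_smul, norm_smul, ha, hu])
    with h | h
  · refine key h hc₂ ?_
    rw [show m + R • a - (c - R • a) = (m - c) + (2 * R) • a by module, norm_add_sq_real,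
      real_inner_smul_right, h0, norm_smul, ha]
    simp [abs_of_pos hR0]
  · refine key h hc₁ ?_
    rw [show m - R • a - (c + R • a) = (m - c) - (2 * R) • a by module, norm_sub_sq_real,
      real_inner_smul_right, h0, norm_smul, ha]
    simp [abs_of_pos hR0]

/-- The set `K` does not stick out of the ball having the segment between a support pair as a
diameter. The function `F` below compares the support functions of `K` and of the ball in the
directions `e + s • a`. -/
lemma subset_closedBall (hV : 2 ≤ Module.finrank ℝ V) {K : Set V} (hK : IsCompact K)
    (hR : RectangleProperty K) {R : ℝ} (hR0 : 0 < R)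
    (hw : ∀ u x y : V, ‖u‖ = 1 → IsSupportPair K u x y → x - y = (2 * R) • u)
    {a c : V} (ha : ‖a‖ = 1) (hc₁ : c + R • a ∈ K) (hc₂ : c - R • a ∈ K) :
    K ⊆ Metric.closedBall c R := by
  have hdiam (x) (hx : x ∈ K) (y) (hy : y ∈ K) : ‖x - y‖ ≤ 2 * R :=
    norm_sub_le_of_width hK hR0 hw hx hy
  have haa : inner ℝ a a = (1 : ℝ) := by rw [real_inner_self_eq_norm_sq, ha]; norm_num
  intro x hx
  rw [mem_closedBall_iff_norm]
  obtain ⟨e, he, hae, α, β, hβ, hxαβ⟩ := exists_decomposition hV ha (x - c)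
  have hea : inner ℝ e a = (0 : ℝ) := by rw [real_inner_comm, hae]
  have hee : inner ℝ e e = (1 : ℝ) := by rw [real_inner_self_eq_norm_sq, he]; norm_num
  have hes (s : ℝ) : ‖e + s • a‖ = √(1 + s ^ 2) := by
    have := norm_sq_smul_add_smul he ha hea 1 s
    rw [one_smul, one_pow] at this
    rw [← this, Real.sqrt_sq (norm_nonneg _)]
  have hpos (s : ℝ) : 0 < √(1 + s ^ 2) := Real.sqrt_pos.2 (by positivity)
  set F : V × ℝ → ℝ := fun P => inner ℝ (P.1 - c) (e + P.2 • a) - R * √(1 + P.2 ^ 2) with hF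
  have hFle (z : V) (hz : z ∈ K) (s : ℝ) : F (z, s) ≤ R * (√(1 + s ^ 2) - |s|) := by
    have h1 := hdiam z hz _ hc₁
    have h2 := hdiam z hz _ hc₂
    have h3 := real_inner_le_norm (z - (c + R • a)) (e + s • a)
    have h4 := real_inner_le_norm (z - (c - R • a)) (e + s • a)
    have e3 : inner ℝ (z - (c + R • a)) (e + s • a) = inner ℝ (z - c) (e + s • a) - R * s := by
      rw [← sub_sub, inner_sub_left (z - c), real_inner_smul_left, inner_add_right a,
        real_inner_smul_right, hae, haa]
      ring
    have e4 : inner ℝ (z - (c - R • a)) (e + s • a) = inner ℝ (z - c) (e + s • a) + R * s := by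
      rw [← sub_add, inner_add_left (z - c), real_inner_smul_left, inner_add_right a,
        real_inner_smul_right, hae, haa]
      ring
    rw [e3, hes] at h3
    rw [e4, hes] at h4
    have h5 := mul_le_mul_of_nonneg_right h1 (hpos s).le
    have h6 := mul_le_mul_of_nonneg_right h2 (hpos s).le
    simp only [hF]
    rcases abs_cases s with ⟨h, -⟩ | ⟨h, -⟩ <;> rw [h] <;> linarith
  have hFnonpos (z : V) (hz : z ∈ K) (s : ℝ) : F (z, s) ≤ 0 := by
    by_contra! hlt
    set δ := F (z, s) / R with hδ
    have hδ0 : 0 < δ := div_pos hlt hR0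
    have hδF : F (z, s) = R * δ := by rw [hδ]; field_simp
    -- The bound on `F` tends to zero at infinity, so values `≥ R * δ` occur only for `|s| ≤ δ⁻¹`.
    have hfar (t : ℝ) (ht : δ ≤ √(1 + t ^ 2) - |t|) : |t| ≤ δ⁻¹ := by
      have h1 : (δ + |t|) ^ 2 ≤ 1 + t ^ 2 := by
        rw [← Real.sq_sqrt (show 0 ≤ 1 + t ^ 2 by positivity)]
        exact pow_le_pow_left₀ (by positivity) (by linarith) 2
      rw [add_sq, sq_abs] at h1
      rw [← one_div, le_div_iff₀ hδ0]
      nlinarith [mul_nonneg hδ0.le (abs_nonneg t), sq_nonneg δ]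
    have hbig (z' : V) (hz' : z' ∈ K) (t : ℝ) (h : F (z, s) ≤ F (z', t)) : |t| ≤ δ⁻¹ := by
      refine hfar t (le_of_mul_le_mul_left ?_ hR0)
      rw [← hδF]
      exact h.trans (hFle z' hz' t)
    have hFc : Continuous F := by fun_prop
    obtain ⟨⟨x₁, s₁⟩, ⟨hx₁, -⟩, hmax⟩ := (hK.prod (isCompact_Icc (a := -δ⁻¹) (b := δ⁻¹))).exists_isMaxOn
      ⟨(z, s), hz, abs_le.1 (hbig z hz s le_rfl)⟩ hFc.continuousOn
    have hzs : F (z, s) ≤ F (x₁, s₁) := hmax ⟨hz, abs_le.1 (hbig z hz s le_rfl)⟩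
    have hglob (z' : V) (hz' : z' ∈ K) (t : ℝ) : F (z', t) ≤ F (x₁, s₁) := by
      rcases le_total (F (z, s)) (F (z', t)) with h | h
      · exact hmax ⟨hz', abs_le.1 (hbig z' hz' t h)⟩
      · exact h.trans hzs
    set r := √(1 + s₁ ^ 2) with hr
    have hr0 : 0 < r := hpos s₁
    -- Stationarity in `s`.
    have hstat : inner ℝ (x₁ - c) a = R * (s₁ / r) := by
      have hsq : HasDerivAt (fun t : ℝ => √(1 + t ^ 2)) (s₁ / r) s₁ := by
        have h1 : HasDerivAt (fun t : ℝ => 1 + t ^ 2) (2 * s₁) s₁ := by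
          simpa using (hasDerivAt_pow 2 s₁).const_add 1
        convert h1.sqrt (by positivity) using 1
        rw [← hr]
        field_simp
      have hder : HasDerivAt (fun t : ℝ => F (x₁, t)) (inner ℝ (x₁ - c) a - R * (s₁ / r)) s₁ := by
        simp only [hF, inner_add_right, real_inner_smul_right]
        refine HasDerivAt.sub ?_ (hsq.const_mul R)
        simpa using ((hasDerivAt_id s₁).mul_const (inner ℝ (x₁ - c) a)).const_add
          (inner ℝ (x₁ - c) e)
      have hloc : IsLocalMax (fun t : ℝ => F (x₁, t)) s₁ :=
        Filter.Eventually.of_forall fun t => hglob x₁ hx₁ t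
      linarith [hloc.hasDerivAt_eq_zero hder]
    set u := r⁻¹ • (e + s₁ • a) with hudef
    have hu : ‖u‖ = 1 := by
      rw [hudef, norm_smul, hes, ← hr, Real.norm_of_nonneg (by positivity)]
      exact inv_mul_cancel₀ hr0.ne'
    obtain ⟨x', y', h'⟩ := exists_isSupportPair hK ⟨x₁, hx₁⟩ u
    have hpair : IsSupportPair K u x₁ y' := by
      refine ⟨hx₁, h'.right_mem, fun z' hz' => ?_, h'.right_le⟩
      have h1 := hglob z' hz' s₁
      simp only [hF] at h1
      rw [inner_sub_left, inner_sub_left] at h1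
      rw [hudef, real_inner_smul_right, real_inner_smul_right]
      exact mul_le_mul_of_nonneg_left (by linarith) (by positivity)
    have hy' : y' = x₁ - R • u - R • u := by
      rw [sub_sub, ← add_smul, ← two_mul, ← hw u x₁ y' hu hpair]
      abel
    have hpair' : IsSupportPair K u ((x₁ - R • u) + R • u) ((x₁ - R • u) - R • u) := by
      rwa [← hy', sub_add_cancel]
    have hua : inner ℝ u a = s₁ / r := by
      rw [hudef, real_inner_smul_left, inner_add_left, hea, real_inner_smul_left, haa]
      field_simp
      ring
    have hmc := eq_of_inner_midpoint_eq_zero hR hR0 hdiam ha hu hc₁ hc₂ hpair' (by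
      rw [show x₁ - R • u - c = (x₁ - c) - R • u by abel, inner_sub_left, hstat,
        real_inner_smul_left, hua, sub_self])
    have hx₁c : x₁ - c = R • u := by rw [← hmc]; abel
    have hF0 : F (x₁, s₁) = 0 := by
      simp only [hF]
      rw [hx₁c, hudef, real_inner_smul_left, real_inner_smul_left, real_inner_self_eq_norm_sq, hes,
        ← hr]
      field_simp
      ring
    linarith
  rcases hβ.eq_or_lt with hβ0 | hβ0
  · -- Here `x` is on the line through the support pair, whose points in `K` are within `2R` of both.
    rw [← hβ0, zero_smul, add_zero] at hxαβ
    have h1 := hdiam x hx _ hc₁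
    have h2 := hdiam x hx _ hc₂
    rw [← sub_sub, hxαβ, ← sub_smul, norm_smul, ha, mul_one, Real.norm_eq_abs, abs_le] at h1
    rw [← sub_add, hxαβ, ← add_smul, norm_smul, ha, mul_one, Real.norm_eq_abs, abs_le] at h2
    rw [hxαβ, norm_smul, ha, mul_one, Real.norm_eq_abs, abs_le]
    constructor <;> linarith
  · have h1 := hFnonpos x hx (α / β)
    simp only [hF] at h1
    rw [← hes] at h1
    have h2 : e + (α / β) • a = β⁻¹ • (x - c) := by
      rw [hxαβ, smul_add, smul_smul, smul_smul, inv_mul_cancel₀ hβ0.ne', one_smul, add_comm,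
        div_eq_inv_mul]
    rw [h2, real_inner_smul_right, real_inner_self_eq_norm_sq, norm_smul,
      Real.norm_of_nonneg (by positivity)] at h1
    have h3 : β⁻¹ * (‖x - c‖ * ‖x - c‖) ≤ β⁻¹ * (R * ‖x - c‖) := by linarith
    have h4 := le_of_mul_le_mul_left h3 (by positivity)
    by_contra! h5
    have h6 : 0 < ‖x - c‖ := hR0.trans h5
    exact absurd (le_of_mul_le_mul_right h4 h6) (not_le.2 h5)

/-! ### The ball is filled -/

lemma closedBall_subset (hV : 2 ≤ Module.finrank ℝ V) {K : Set V} (hR : RectangleProperty K)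
    {R : ℝ} {c : V} (hsub : K ⊆ Metric.closedBall c R) (hsph : Metric.sphere c R ⊆ K) :
    Metric.closedBall c R ⊆ K := by
  intro z hz
  have : Nontrivial V := Module.nontrivial_of_finrank_pos (R := ℝ) (by omega)
  rw [mem_closedBall_iff_norm] at hz
  rcases hz.eq_or_lt with hz | hz
  · exact hsph (mem_sphere_iff_norm.2 hz)
  obtain ⟨u, hu, hzu⟩ : ∃ u : V, ‖u‖ = 1 ∧ z - c = ‖z - c‖ • u := by
    by_cases h0 : z - c = 0
    · obtain ⟨u, hu⟩ := exists_norm_eq V zero_le_one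
      exact ⟨u, hu, by rw [h0, norm_zero, zero_smul]⟩
    · exact ⟨‖z - c‖⁻¹ • (z - c), norm_smul_inv_norm h0,
        by rw [smul_smul, mul_inv_cancel₀ (norm_ne_zero_iff.2 h0), one_smul]⟩
  obtain ⟨e, he, hue⟩ := exists_unit_orthogonal hV hu
  set ρ := ‖z - c‖ with hρ
  have hρ0 : 0 ≤ ρ := norm_nonneg _
  have hR0 : 0 < R := hρ0.trans_lt hz
  have hz' : z = c + ρ • u := by rw [← hzu]; abel
  set t := √(R ^ 2 - ρ ^ 2) with ht
  have ht2 : t ^ 2 = R ^ 2 - ρ ^ 2 := Real.sq_sqrt (by nlinarith)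
  have hnorm (α β : ℝ) : ‖α • u + β • e‖ ^ 2 = α ^ 2 + β ^ 2 := norm_sq_smul_add_smul hu he hue α β
  have hmem {α β : ℝ} (h : α ^ 2 + β ^ 2 = R ^ 2) :
      c + (α • u + β • e) ∈ frontier K := by
    have hn : ‖α • u + β • e‖ = R := by
      rw [← sq_eq_sq₀ (norm_nonneg _) hR0.le, hnorm, h]
    have hK : c + (α • u + β • e) ∈ K := hsph (by simp [hn])
    refine mem_frontier_of_inner_le (u := R⁻¹ • (α • u + β • e)) ?_ hK fun w hw => ?_
    · rw [norm_smul, hn, Real.norm_of_nonneg (by positivity), inv_mul_cancel₀ hR0.ne']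
    · rw [real_inner_smul_right, real_inner_smul_right]
      refine mul_le_mul_of_nonneg_left ?_ (by positivity)
      have h1 := mem_closedBall_iff_norm.1 (hsub hw)
      have h2 := real_inner_le_norm (w - c) (α • u + β • e)
      have h3 := mul_le_mul_of_nonneg_right h1 hR0.le
      rw [hn, inner_sub_left] at h2
      rw [inner_add_left, real_inner_self_eq_norm_sq, hn]
      linarith
  have hp := hmem (α := R) (β := 0) (by ring)
  have hq := hmem (α := ρ) (β := t) (by rw [ht2]; ring)
  refine (hR _ hp _ hq z (c + (R • u + t • e)) (by rw [hz']; module) ?_).resolve_right fun h => ?_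
  · rw [← sq_eq_sq₀ (norm_nonneg _) (norm_nonneg _),
      show z - (c + (R • u + t • e)) = (ρ - R) • u + (-t) • e by rw [hz']; module,
      show c + (R • u + (0 : ℝ) • e) - (c + (ρ • u + t • e)) = (R - ρ) • u + (-t) • e by module,
      hnorm, hnorm]
    ring
  · -- The fourth vertex is at squared distance `2R² - ρ² > R²` from `c`.
    have h1 := mem_closedBall_iff_norm.1 (hsub h)
    rw [add_sub_cancel_left] at h1
    have h2 := pow_le_pow_left₀ (norm_nonneg _) h1 2
    rw [hnorm, ht2] at h2
    nlinarith

/-- A compact set of constant width `2R` contained in a ball of radius `R` contains its sphere. -/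
lemma sphere_subset_of_width {K : Set V} (hK : IsCompact K) (hne : K.Nonempty) {R : ℝ} (hR0 : 0 < R)
    (hw : ∀ u x y : V, ‖u‖ = 1 → IsSupportPair K u x y → x - y = (2 * R) • u) {c : V}
    (hsub : K ⊆ Metric.closedBall c R) : Metric.sphere c R ⊆ K := by
  intro z hz
  rw [mem_sphere_iff_norm] at hz
  have hu : ‖R⁻¹ • (z - c)‖ = 1 := by
    rw [norm_smul, hz, Real.norm_of_nonneg (by positivity), inv_mul_cancel₀ hR0.ne']
  set u := R⁻¹ • (z - c) with hudef
  have hzu : z = c + R • u := by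
    rw [hudef, smul_smul, mul_inv_cancel₀ hR0.ne', one_smul]; abel
  obtain ⟨x, y, h⟩ := exists_isSupportPair hK hne u
  have h1 := mem_closedBall_iff_norm.1 (hsub h.left_mem)
  have h2 := mem_closedBall_iff_norm.1 (hsub h.right_mem)
  have h3 := hw u x y hu h
  -- By the parallelogram law the midpoint of `x` and `y` is `c`.
  have h4 := parallelogram_law_with_norm ℝ (x - c) (y - c)
  rw [sub_sub_sub_cancel_right, h3, norm_smul, hu, Real.norm_of_nonneg (by positivity)] at h4
  have h5 : ‖x - c + (y - c)‖ = 0 := by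
    nlinarith [norm_nonneg (x - c), norm_nonneg (y - c), norm_nonneg (x - c + (y - c))]
  have h6 : x - c + (y - c) = 0 := norm_eq_zero.1 h5
  have h7 : z = x := by
    have : (2 : ℝ) • (x - z) = (x - c + (y - c)) + (x - y - (2 * R) • u) := by rw [hzu]; module
    rw [h6, h3, sub_self, add_zero] at this
    exact (sub_eq_zero.1 ((smul_eq_zero.1 this).resolve_left two_ne_zero)).symm
  rw [h7]
  exact h.left_mem

theorem RectangleProperty.exists_eq_closedBall (hV : 2 ≤ Module.finrank ℝ V) {K : Set V}
    (hK : IsCompact K) (hK2 : K.Nontrivial) (hR : RectangleProperty K) :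
    ∃ (c : V) (r : ℝ), 0 < r ∧ K = Metric.closedBall c r := by
  obtain ⟨R, hR0, hw⟩ := exists_width hV hK hK2 hR
  have : Nontrivial V := Module.nontrivial_of_finrank_pos (R := ℝ) (by omega)
  obtain ⟨a, ha⟩ := exists_norm_eq V zero_le_one
  obtain ⟨x, y, h⟩ := exists_isSupportPair hK hK2.nonempty a
  have hxy := hw a x y ha h
  have hx : x = (x - R • a) + R • a := by abel
  have hy : y = (x - R • a) - R • a := by
    rw [sub_sub, ← add_smul, ← two_mul, ← hxy]; abel
  have hsub : K ⊆ Metric.closedBall (x - R • a) R :=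
    subset_closedBall hV hK hR hR0 hw ha (hx ▸ h.left_mem) (hy ▸ h.right_mem)
  exact ⟨x - R • a, R, hR0, hsub.antisymm (closedBall_subset hV hR hsub
    (sphere_subset_of_width hK hK2.nonempty hR0 hw hsub))⟩

end Rectangle

theorem theorem4p1 (n : ℕ) (hn : 2 ≤ n) (K : Set (EuclideanSpace ℝ (Fin n)))
    (hK : IsCompact K) (hK2 : K.Nontrivial)
    (h : ∀ x ∈ frontier K, ∀ y ∈ frontier K,
      ∀ σ ∈ Metric.sphere (0 : EuclideanSpace ℝ (Fin n)) 1,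
        (1 / 2 : ℝ) • (x + y) + (‖x - y‖ / 2) • σ ∈ K ∨
        (1 / 2 : ℝ) • (x + y) - (‖x - y‖ / 2) • σ ∈ K) :
    ∃ (c : EuclideanSpace ℝ (Fin n)) (r : ℝ), 0 < r ∧ K = Metric.closedBall c r := by
  refine RectangleProperty.exists_eq_closedBall (by simpa using hn) hK hK2 ?_
  intro x hx y hy p q hpq hnorm
  by_cases h0 : ‖x - y‖ = 0
  · -- A degenerate rectangle: all four vertices coincide.
    have h1 : x = y := sub_eq_zero.1 (norm_eq_zero.1 h0)
    have h2 : p = q := sub_eq_zero.1 (norm_eq_zero.1 (hnorm.trans h0))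
    have h3 : (2 : ℝ) • (p - x) = 0 := by
      rw [← h1, ← h2] at hpq
      rw [smul_sub, two_smul, two_smul, hpq, sub_self]
    rw [sub_eq_zero.1 ((smul_eq_zero.1 h3).resolve_left two_ne_zero)]
    exact Or.inl (hK.isClosed.frontier_subset hx)
  · have hσ : (‖x - y‖ / 2) • (‖x - y‖⁻¹ • (p - q)) = (1 / 2 : ℝ) • (p - q) := by
      rw [smul_smul]
      congr 1
      field_simp
    have := h x hx y hy (‖x - y‖⁻¹ • (p - q)) (by
      rw [mem_sphere_zero_iff_norm, norm_smul, hnorm, norm_inv, norm_norm, inv_mul_cancel₀ h0])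
    rw [hσ, ← hpq] at this
    rwa [show (1 / 2 : ℝ) • (p + q) + (1 / 2 : ℝ) • (p - q) = p by module,
      show (1 / 2 : ℝ) • (p + q) - (1 / 2 : ℝ) • (p - q) = q by module] at this
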